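/- Let $Q=(q_0,q_1,q_2,\dots)$ be a $Q_\infty$-vector, i.e. $q_i>0$ for all $i\ge 0$ and $\sum_{i\ge 0}q_i=1$. Divide $[0,1)$, from left to right, into the semi-intervals (closed on the left, open on the right) $\Delta_0,\Delta_1,\Delta_2,\dots$ with $|\Delta_a|=q_a$, the cylinders of rank $1$; and, for $n\ge2$, divide every cylinder $\Delta_{a_1\cdots a_{n-1}}$ of rank $n-1$, from left to right, into the semi-intervals $\Delta_{a_1\cdots a_{n-1}a}$, $a=0,1,2,\dots$, with $|\Delta_{a_1\cdots a_{n-1}a}|=q_a\,|\Delta_{a_1\cdots a_{n-1}}|$, the cylinders of rank $n$. Let $\Phi=\Phi(Q)$ be the family of all cylinders of all ranks $n\ge1$. For $E\subseteq[0,1)$ and $s\ge0$ put $$H^s(E,\Phi)=\lim_{\varepsilon\to0}\ \inf\Big\{\sum_j|E_j|^s\Big\},$$ where $|\cdot|$ denotes the diameter and the infimum is over all at most countable coverings $\{E_j\}$ of $E$ with $E_j\in\Phi$ and $|E_j|\le\varepsilon$; put $\dim_H(E,\Phi)=\inf\{s\ge0: H^s(E,\Phi)=0\}$. The family $\Phi$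 is called faithful (for the Hausdorff dimension calculation on the unit interval) if it is a fine family of coverings, i.e. its members are subsets of $[0,1)$ and for every $\varepsilon>0$ the interval $[0,1)$ has an at most countable covering by members of $\Phi$ of diameter at most $\varepsilon$, and if $\dim_H(E,\Phi)=\dim_H(E)$, the classical Hausdorff dimension, for every $E\subseteq[0,1)$. **Theorem.** The family $\Phi(Q)$ is faithful if and only if for all $\alpha\in(0,1)$ and $\delta\in(0,\alpha)$ there is a positive integer $N=N(\alpha,\delta)$ such that for all integers $n,M>N$ $$\Big(\sum_{i=n}^{n+M}q_i\Big)^{\alpha-\delta}\ \ge\ \sum_{i=n}^{n+M}q_i^{\alpha}.$$ -/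

import Mathlib

open scoped ENNReal NNReal

noncomputable section

/-- A `Q_∞`-vector: a sequence of positive reals with sum `1`. -/
structure IsQInfVector (q : ℕ → ℝ) : Prop where
  pos : ∀ i, 0 < q i
  hasSum : HasSum q 1

/-- The length `q_{α₁} ⋯ q_{αₙ}` of the cylinder of rank `n` with digits `α 0, …, α (n - 1)`. -/
def cylLength (q : ℕ → ℝ) (α : ℕ → ℕ) (n : ℕ) : ℝ :=
  ∏ k ∈ Finset.range n, q (α k)

/-- The left endpoint of the cylinder of rank `n` with digits `α 0, …, α (n - 1)`.
A cylinder is cut, from the left to the right, into the cylinders of the next rank with last digit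
`0, 1, 2, …`, so the one with last digit `a` starts after the pieces with last digits `i < a`. -/
def cylLeft (q : ℕ → ℝ) (α : ℕ → ℕ) : ℕ → ℝ
  | 0 => 0
  | n + 1 => cylLeft q α n + cylLength q α n * ∑ i ∈ Finset.range (α n), q i

/-- The cylinder `Δ_{α₁ … αₙ}` of rank `n`, a semi-interval
(only the digits `α 0, …, α (n - 1)` matter; rank `0` gives `[0, 1)`). -/
def cylinder (q : ℕ → ℝ) (α : ℕ → ℕ) (n : ℕ) : Set ℝ :=
  Set.Ico (cylLeft q α n) (cylLeft q α n + cylLength q α n)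

/-- The family `Φ(Q)` of all cylinders of all ranks `n ≥ 1`. -/
def cylinderFamily (q : ℕ → ℝ) : Set (Set ℝ) :=
  {U | ∃ (α : ℕ → ℕ) (n : ℕ), 1 ≤ n ∧ U = cylinder q α n}

/-- `C` is an at most countable `ε`-covering of `E` by members of `Φ`. -/
structure IsEpsCovering (Φ : Set (Set ℝ)) (ε : ℝ≥0∞) (E : Set ℝ) (C : Set (Set ℝ)) : Prop where
  countable : C.Countable
  subset : C ⊆ Φ
  diam_le : ∀ U ∈ C, Metric.ediam U ≤ ε
  cover : E ⊆ ⋃₀ C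

/-- The `s`-dimensional Hausdorff measure `H^s(E, Φ)` of `E` with respect to the family `Φ`:
the limit as `ε → 0` (a supremum, by monotonicity) of the infimum of `∑ |E_j|^s` over the
`ε`-coverings `{E_j}` of `E` by members of `Φ`. -/
def familyHausdorffMeasure (Φ : Set (Set ℝ)) (s : ℝ≥0) (E : Set ℝ) : ℝ≥0∞ :=
  ⨆ (ε : ℝ≥0∞) (_ : 0 < ε), ⨅ (C : Set (Set ℝ)) (_ : IsEpsCovering Φ ε E C),
    ∑' U : C, Metric.ediam (U : Set ℝ) ^ (s : ℝ)

/-- The Hausdorff dimension `dim_H(E, Φ) = inf {s ≥ 0 : H^s(E, Φ) = 0}` with respect to `Φ`. -/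
def familyDimH (Φ : Set (Set ℝ)) (E : Set ℝ) : ℝ≥0∞ :=
  ⨅ (s : ℝ≥0) (_ : familyHausdorffMeasure Φ s E = 0), (s : ℝ≥0∞)

/-- `Φ` is a fine family of coverings of `X`: it consists of subsets of `X`, and `X` has
`ε`-coverings by members of `Φ` for every `ε > 0`. -/
structure IsFineFamily (X : Set ℝ) (Φ : Set (Set ℝ)) : Prop where
  subset : ∀ U ∈ Φ, U ⊆ X
  exists_covering : ∀ ε : ℝ≥0∞, 0 < ε → ∃ C, IsEpsCovering Φ ε X C

/-- `Φ` is a faithful family of coverings on `X`: it is fine, and `dim_H(E, Φ)` is the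
classical Hausdorff dimension of `E` for every `E ⊆ X`. -/
structure IsFaithfulFamily (X : Set ℝ) (Φ : Set (Set ℝ)) : Prop where
  fine : IsFineFamily X Φ
  dim_eq : ∀ E ⊆ X, familyDimH Φ E = dimH E

end

/-!
Restricting the coverings to a family can only increase the Hausdorff dimension, and the
cylinders of rank `n` show that `dim_H(E, Φ) ≤ 1`; so faithfulness is a statement about how
economically a short interval can be covered by cylinders, each of which has infinitely many
children.

Suppose the condition on `q` holds, and let `I = [a, b]` have length at most `l < 1`. For `x ∈ I`
take the first rank at which the cylinder of `x` is either no longer than `l` or free of both `a`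
and `b`. Its parent is longer than `l` and contains `a` or `b`, so each endpoint accounts for at
most one parent per rank. The digits of the children of a parent which lie in `I` form a block; the
condition bounds their contribution to `∑ |E_j| ^ s` by a constant times `l ^ (s - δ)`, and the one
further child, which contains an endpoint, has length at most `l`
(`coveringOuterMeasure_piecesOfRank_le`). As the parents are longer than `l` and their lengths decay
geometrically with the rank, giving up another `l ^ δ` makes the sum over all ranks converge
(`exists_coveringOuterMeasure_Icc_le`), whence `H^s(E, Φ) = 0` as soon as the Hausdorff measure of
`E` in dimension `s - 2 δ` vanishes (`familyHausdorffMeasure_eq_zero_of_forall_Icc`).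

Suppose the condition fails for `α` and `δ`. Then there are blocks of digits `B`, arbitrarily far
out, with `(∑_B q_i) ^ (α - δ) < ∑_B q_i ^ α`. Choose blocks `B_0, B_1, …` of this kind, each tiny
in terms of the preceding ones, and let `E` be the set of points whose `k`-th digit lies in `B_k`
for every `k`. Covering `E` by the hulls of the blocks gives `dim_H E ≤ δ / 2`
(`hausdorffMeasure_digitSet_eq_zero`). Coverings by cylinders cannot group the digits of a block:
the product measure with weights `q_i ^ α / ∑_B q_j ^ α` gives every cylinder mass at most the
`δ`-th power of its length, so `dim_H(E, Φ) ≥ δ` (`ofReal_le_familyDimH_digitSet`).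
-/

open Filter Topology
open MeasureTheory hiding cylinder

/-! ### Cylinders and digit expansions -/

namespace IsQInfVector

variable {q : ℕ → ℝ}

theorem sum_le_one (hq : IsQInfVector q) (s : Finset ℕ) : ∑ i ∈ s, q i ≤ 1 :=
  sum_le_hasSum s (fun i _ => (hq.pos i).le) hq.hasSum

theorem sum_range_lt_one (hq : IsQInfVector q) (a : ℕ) : ∑ i ∈ Finset.range a, q i < 1 := by
  have h := hq.sum_le_one (Finset.range (a + 1))
  rw [Finset.sum_range_succ] at h
  linarith [hq.pos a]

theorem exists_le_lt_one (hq : IsQInfVector q) : ∃ r : ℝ, 0 < r ∧ r < 1 ∧ ∀ i, q i ≤ r := by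
  have h01 := hq.sum_le_one {0, 1}
  rw [Finset.sum_pair (by norm_num)] at h01
  refine ⟨max (q 0) (1 - q 0), lt_max_of_lt_left (hq.pos 0),
    max_lt (by linarith [hq.pos 1]) (by linarith [hq.pos 0]), fun i => ?_⟩
  rcases eq_or_ne i 0 with rfl | hi
  · exact le_max_left _ _
  · have h := hq.sum_le_one {0, i}
    rw [Finset.sum_pair hi.symm] at h
    exact le_max_of_le_right (by linarith)

theorem strictMono_sum_range (hq : IsQInfVector q) :
    StrictMono fun a => ∑ i ∈ Finset.range a, q i :=
  strictMono_nat_of_lt_succ fun a => by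
    simp only [Finset.sum_range_succ]
    linarith [hq.pos a]

end IsQInfVector

section Cylinders

variable {q : ℕ → ℝ} {α β : ℕ → ℕ} {n : ℕ}

theorem cylLength_succ (q : ℕ → ℝ) (α : ℕ → ℕ) (n : ℕ) :
    cylLength q α (n + 1) = cylLength q α n * q (α n) :=
  Finset.prod_range_succ _ _

theorem cylLength_pos (hq : IsQInfVector q) (α : ℕ → ℕ) (n : ℕ) : 0 < cylLength q α n :=
  Finset.prod_pos fun _ _ => hq.pos _

theorem cylLength_le_pow (hq : IsQInfVector q) {r : ℝ} (hr : ∀ i, q i ≤ r) (α : ℕ → ℕ) (n : ℕ) :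
    cylLength q α n ≤ r ^ n := by
  simpa [cylLength] using
    Finset.prod_le_prod (s := Finset.range n) (fun i _ => (hq.pos (α i)).le) fun i _ => hr (α i)

theorem cylLength_le_one (hq : IsQInfVector q) (α : ℕ → ℕ) (n : ℕ) : cylLength q α n ≤ 1 := by
  obtain ⟨r, h0, h1, hr⟩ := hq.exists_le_lt_one
  exact (cylLength_le_pow hq hr α n).trans (pow_le_one₀ h0.le h1.le)

theorem cylLength_congr (h : ∀ k < n, α k = β k) : cylLength q α n = cylLength q β n :=
  Finset.prod_congr rfl fun k hk => by rw [h k (Finset.mem_range.1 hk)]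

theorem cylLeft_congr : ∀ {n : ℕ}, (∀ k < n, α k = β k) → cylLeft q α n = cylLeft q β n
  | 0, _ => rfl
  | n + 1, h => by
    have h' : ∀ k < n, α k = β k := fun k hk => h k (hk.trans n.lt_succ_self)
    simp only [cylLeft, cylLeft_congr h', cylLength_congr h', h n n.lt_succ_self]

theorem cylinder_congr (h : ∀ k < n, α k = β k) : cylinder q α n = cylinder q β n := by
  rw [cylinder, cylinder, cylLeft_congr h, cylLength_congr h]

theorem cylinder_zero (q : ℕ → ℝ) (α : ℕ → ℕ) : cylinder q α 0 = Set.Ico 0 1 := by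
  simp [cylinder, cylLeft, cylLength]

theorem cylinder_succ (q : ℕ → ℝ) (α : ℕ → ℕ) (n : ℕ) : cylinder q α (n + 1) =
    Set.Ico (cylLeft q α n + cylLength q α n * ∑ i ∈ Finset.range (α n), q i)
      (cylLeft q α n + cylLength q α n * ∑ i ∈ Finset.range (α n + 1), q i) := by
  rw [cylinder, cylLength_succ, cylLeft, Finset.sum_range_succ]
  congr 1
  ring

theorem ediam_cylinder (q : ℕ → ℝ) (α : ℕ → ℕ) (n : ℕ) :
    Metric.ediam (cylinder q α n) = ENNReal.ofReal (cylLength q α n) := by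
  rw [cylinder, Real.ediam_Ico, add_sub_cancel_left]

theorem monotone_cylLeft (hq : IsQInfVector q) (α : ℕ → ℕ) : Monotone (cylLeft q α) :=
  monotone_nat_of_le_succ fun n => by
    have := mul_nonneg (cylLength_pos hq α n).le
      (Finset.sum_nonneg fun i (_ : i ∈ Finset.range (α n)) => (hq.pos i).le)
    rw [cylLeft]
    linarith

theorem strictAnti_cylRight (hq : IsQInfVector q) (α : ℕ → ℕ) :
    StrictAnti fun n => cylLeft q α n + cylLength q α n :=
  strictAnti_nat_of_succ_lt fun n => by
    have h := mul_lt_mul_of_pos_left (hq.sum_range_lt_one (α n + 1)) (cylLength_pos hq α n)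
    rw [Finset.sum_range_succ] at h
    simp only [cylLength_succ, cylLeft]
    linarith

theorem antitone_cylinder (hq : IsQInfVector q) (α : ℕ → ℕ) : Antitone (cylinder q α) :=
  fun _ _ h => Set.Ico_subset_Ico (monotone_cylLeft hq α h) ((strictAnti_cylRight hq α).antitone h)

theorem cylinder_subset_Ico (hq : IsQInfVector q) (α : ℕ → ℕ) (n : ℕ) :
    cylinder q α n ⊆ Set.Ico 0 1 :=
  cylinder_zero q α ▸ antitone_cylinder hq α n.zero_le

theorem eq_of_mem_cylinder (hq : IsQInfVector q) {x : ℝ} :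
    ∀ {n : ℕ}, x ∈ cylinder q α n → x ∈ cylinder q β n → ∀ k < n, α k = β k
  | 0, _, _ => fun k hk => absurd hk k.not_lt_zero
  | n + 1, ha, hb => by
    have ih := eq_of_mem_cylinder hq (antitone_cylinder hq α n.le_succ ha)
      (antitone_cylinder hq β n.le_succ hb)
    rw [cylinder_succ] at ha hb
    rw [← cylLeft_congr ih, ← cylLength_congr ih] at hb
    have hL := cylLength_pos hq α n
    have key : ∀ {a b : ℕ}, cylLeft q α n + cylLength q α n * ∑ i ∈ Finset.range a, q i ≤ x →
        x < cylLeft q α n + cylLength q α n * ∑ i ∈ Finset.range (b + 1), q i → a ≤ b := by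
      intro a b h1 h2
      have h3 := lt_of_mul_lt_mul_left (lt_of_add_lt_add_left (h1.trans_lt h2)) hL.le
      exact Nat.lt_succ_iff.1 (hq.strictMono_sum_range.lt_iff_lt.1 h3)
    have hn : α n = β n := le_antisymm (key ha.1 hb.2) (key hb.1 ha.2)
    intro k hk
    rcases Nat.lt_succ_iff_lt_or_eq.1 hk with h | rfl
    exacts [ih k h, hn]

theorem exists_digit (hq : IsQInfVector q) {u : ℝ} (hu : u ∈ Set.Ico (0 : ℝ) 1) :
    ∃ a : ℕ, ∑ i ∈ Finset.range a, q i ≤ u ∧ u < ∑ i ∈ Finset.range (a + 1), q i := by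
  classical
  have hex : ∃ a, u < ∑ i ∈ Finset.range a, q i :=
    (hq.hasSum.tendsto_sum_nat.eventually (lt_mem_nhds hu.2)).exists
  obtain ⟨a, ha⟩ : ∃ a, Nat.find hex = a + 1 := by
    refine Nat.exists_eq_succ_of_ne_zero fun h0 => ?_
    have := Nat.find_spec hex
    rw [h0] at this
    simp only [Finset.range_zero, Finset.sum_empty] at this
    exact absurd hu.1 this.not_ge
  exact ⟨a, not_lt.1 (Nat.find_min hex (by omega)), ha ▸ Nat.find_spec hex⟩

theorem exists_update_mem_cylinder (hq : IsQInfVector q) {x : ℝ} (hx : x ∈ cylinder q α n) :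
    ∃ a, x ∈ cylinder q (Function.update α n a) (n + 1) := by
  have hL := cylLength_pos hq α n
  obtain ⟨a, h1, h2⟩ := exists_digit hq (u := (x - cylLeft q α n) / cylLength q α n)
    ⟨div_nonneg (sub_nonneg.2 hx.1) hL.le, (div_lt_one hL).2 (by linarith [hx.2])⟩
  have hc : ∀ k < n, Function.update α n a k = α k := fun k hk =>
    Function.update_of_ne hk.ne _ _
  refine ⟨a, ?_⟩
  rw [cylinder_succ, cylLeft_congr hc, cylLength_congr hc, Function.update_self]
  rw [le_div_iff₀ hL] at h1
  rw [div_lt_iff₀ hL] at h2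
  constructor <;> linarith

/-- Every point of `[0, 1)` has a digit expansion. -/
theorem exists_forall_mem_cylinder (hq : IsQInfVector q) {x : ℝ} (hx : x ∈ Set.Ico (0 : ℝ) 1) :
    ∃ α : ℕ → ℕ, ∀ n, x ∈ cylinder q α n := by
  have h : ∀ n, ∃ α : ℕ → ℕ, x ∈ cylinder q α n := by
    intro n
    induction n with
    | zero => exact ⟨0, by rwa [cylinder_zero]⟩
    | succ n ih =>
      obtain ⟨α, hα⟩ := ih
      obtain ⟨a, ha⟩ := exists_update_mem_cylinder hq hα
      exact ⟨_, ha⟩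
  choose A hA using h
  -- By uniqueness of digits the expansions of all lengths fit together along the diagonal.
  refine ⟨fun k => A (k + 1) k, fun n => ?_⟩
  rw [cylinder_congr (β := A n)]
  · exact hA n
  · intro k hk
    exact eq_of_mem_cylinder hq (hA (k + 1)) (antitone_cylinder hq _ hk (hA n)) k k.lt_succ_self

/-- For each rank at most one cylinder contains `x`, and these cylinders are nested. For
`x ∉ [0, 1)` no cylinder contains `x` and any `α` will do. -/
theorem exists_forall_eq_of_mem_cylinder (hq : IsQInfVector q) (x : ℝ) :
    ∃ α : ℕ → ℕ, ∀ (β : ℕ → ℕ) (n : ℕ), x ∈ cylinder q β n → ∀ k < n, β k = α k := by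
  by_cases hx : x ∈ Set.Ico (0 : ℝ) 1
  · obtain ⟨α, hα⟩ := exists_forall_mem_cylinder hq hx
    exact ⟨α, fun β n h => eq_of_mem_cylinder hq h (hα n)⟩
  · exact ⟨0, fun β n h => absurd (cylinder_subset_Ico hq β n h) hx⟩

theorem exists_mem_iInter_cylinder (hq : IsQInfVector q) (α : ℕ → ℕ) :
    ∃ x, ∀ n, x ∈ cylinder q α n := by
  have hle : ∀ m n, cylLeft q α m ≤ cylLeft q α n + cylLength q α n := by
    intro m n
    rcases le_total m n with h | h
    · linarith [monotone_cylLeft hq α h, cylLength_pos hq α n]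
    · have : cylLeft q α m + cylLength q α m ≤ cylLeft q α n + cylLength q α n :=
        (strictAnti_cylRight hq α).antitone h
      linarith [cylLength_pos hq α m]
  have hbdd : BddAbove (Set.range (cylLeft q α)) :=
    ⟨cylLeft q α 0 + cylLength q α 0, Set.forall_mem_range.2 fun m => hle m 0⟩
  -- The right endpoints decrease strictly, so the limit point avoids all of them.
  exact ⟨⨆ m, cylLeft q α m, fun n => ⟨le_ciSup hbdd n,
    (ciSup_le fun m => hle m (n + 1)).trans_lt (strictAnti_cylRight hq α n.lt_succ_self)⟩⟩

/-- The point with digits `α 0, α 1, …`. -/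
noncomputable def codePoint (hq : IsQInfVector q) (α : ℕ → ℕ) : ℝ :=
  (exists_mem_iInter_cylinder hq α).choose

theorem codePoint_mem_cylinder (hq : IsQInfVector q) (α : ℕ → ℕ) (n : ℕ) :
    codePoint hq α ∈ cylinder q α n :=
  (exists_mem_iInter_cylinder hq α).choose_spec n

end Cylinders

/-! ### The pre-measures of a family of sets -/

/-- The `ε`-approximation `inf ∑ |E_j| ^ s` of `H^s(E, Φ)`, as an outer measure in `E`. -/
noncomputable def coveringOuterMeasure (Φ : Set (Set ℝ)) (s : ℝ≥0) (ε : ℝ≥0∞) :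
    OuterMeasure ℝ where
  measureOf E := ⨅ (C : Set (Set ℝ)) (_ : IsEpsCovering Φ ε E C),
    ∑' U : C, Metric.ediam (U : Set ℝ) ^ (s : ℝ)
  empty := by
    have hcov : IsEpsCovering Φ ε ∅ ∅ :=
      ⟨Set.countable_empty, Set.empty_subset _, by simp, by simp⟩
    exact le_antisymm ((iInf₂_le ∅ hcov).trans (by simp)) zero_le
  mono := fun h => iInf_mono fun _ => iInf_mono' fun hC =>
    ⟨⟨hC.countable, hC.subset, hC.diam_le, h.trans hC.cover⟩, le_rfl⟩
  iUnion_nat := fun E _ => by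
    refine ENNReal.le_of_forall_pos_le_add fun η hη hfin => ?_
    obtain ⟨η', hpos, hsum⟩ := ENNReal.exists_pos_sum_of_countable (ENNReal.coe_pos.2 hη).ne' ℕ
    have h : ∀ i, ∃ C : Set (Set ℝ), IsEpsCovering Φ ε (E i) C ∧
        ∑' U : C, Metric.ediam (U : Set ℝ) ^ (s : ℝ) ≤
          (⨅ (C : Set (Set ℝ)) (_ : IsEpsCovering Φ ε (E i) C),
            ∑' U : C, Metric.ediam (U : Set ℝ) ^ (s : ℝ)) + η' i := by
      intro i
      have hlt := ENNReal.lt_add_right (ne_top_of_le_ne_top hfin.ne (ENNReal.le_tsum i))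
        (ENNReal.coe_pos.2 (hpos i)).ne'
      simp only [iInf_lt_iff] at hlt
      obtain ⟨C, hC, hle⟩ := hlt
      exact ⟨C, hC, hle.le⟩
    choose C hC hle using h
    have hcov : IsEpsCovering Φ ε (⋃ i, E i) (⋃ i, C i) :=
      { countable := Set.countable_iUnion fun i => (hC i).countable
        subset := Set.iUnion_subset fun i => (hC i).subset
        diam_le := fun U hU =>
          let ⟨i, hi⟩ := Set.mem_iUnion.1 hU
          (hC i).diam_le U hi
        cover := Set.iUnion_subset fun i =>
          (hC i).cover.trans (Set.sUnion_subset_sUnion (Set.subset_iUnion C i)) }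
    refine (iInf₂_le (⋃ i, C i) hcov).trans ?_
    refine (ENNReal.tsum_iUnion_le_tsum (fun U : Set ℝ => Metric.ediam U ^ (s : ℝ)) C).trans ?_
    refine (ENNReal.tsum_le_tsum hle).trans ?_
    rw [ENNReal.tsum_add]
    gcongr

section Family

variable {Φ : Set (Set ℝ)} {s : ℝ≥0} {ε : ℝ≥0∞} {E : Set ℝ}

theorem coveringOuterMeasure_le {C : Set (Set ℝ)} (hC : IsEpsCovering Φ ε E C) :
    coveringOuterMeasure Φ s ε E ≤ ∑' U : C, Metric.ediam (U : Set ℝ) ^ (s : ℝ) :=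
  iInf₂_le C hC

theorem coveringOuterMeasure_le_ediam_rpow {U : Set ℝ} (hU : U ∈ Φ) (hε : Metric.ediam U ≤ ε) :
    coveringOuterMeasure Φ s ε U ≤ Metric.ediam U ^ (s : ℝ) := by
  refine (coveringOuterMeasure_le (C := {U}) ⟨Set.countable_singleton U, by simpa, by simpa,
    by simp⟩).trans ?_
  rw [tsum_singleton U fun U : Set ℝ => Metric.ediam U ^ (s : ℝ)]

theorem coveringOuterMeasure_anti {ε' : ℝ≥0∞} (h : ε' ≤ ε) :
    coveringOuterMeasure Φ s ε E ≤ coveringOuterMeasure Φ s ε' E :=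
  iInf_mono fun _ => iInf_mono' fun hC =>
    ⟨⟨hC.countable, hC.subset, fun U hU => (hC.diam_le U hU).trans h, hC.cover⟩, le_rfl⟩

theorem familyHausdorffMeasure_eq_zero_iff :
    familyHausdorffMeasure Φ s E = 0 ↔ ∀ ε, 0 < ε → coveringOuterMeasure Φ s ε E = 0 := by
  change (⨆ (ε : ℝ≥0∞) (_ : 0 < ε), coveringOuterMeasure Φ s ε E) = 0 ↔ _
  simp [ENNReal.iSup_eq_zero]

theorem hausdorffMeasure_eq_zero_of_family (h : familyHausdorffMeasure Φ s E = 0) :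
    Measure.hausdorffMeasure (s : ℝ) E = 0 := by
  rw [familyHausdorffMeasure_eq_zero_iff] at h
  have hpos : ∀ n : ℕ, (0 : ℝ≥0∞) < (n : ℝ≥0∞)⁻¹ := fun n =>
    ENNReal.inv_pos.2 (ENNReal.natCast_ne_top n)
  have hC : ∀ n : ℕ, ∃ C : Set (Set ℝ), IsEpsCovering Φ (n : ℝ≥0∞)⁻¹ E C ∧
      ∑' U : C, Metric.ediam (U : Set ℝ) ^ (s : ℝ) < (n : ℝ≥0∞)⁻¹ := by
    intro n
    have hlt := (h _ (hpos n)).trans_lt (hpos n)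
    change (⨅ (C : Set (Set ℝ)) (_ : IsEpsCovering Φ (n : ℝ≥0∞)⁻¹ E C),
      ∑' U : C, Metric.ediam (U : Set ℝ) ^ (s : ℝ)) < _ at hlt
    simpa only [iInf_lt_iff, exists_prop] using hlt
  choose C hC hlt using hC
  have : ∀ n, Countable (C n) := fun n => (hC n).countable.to_subtype
  have hle := Measure.hausdorffMeasure_le_liminf_tsum (s : ℝ) E (l := atTop)
    (fun n : ℕ => (n : ℝ≥0∞)⁻¹) ENNReal.tendsto_inv_nat_nhds_zero
    (fun n (U : C n) => (U : Set ℝ)) (Eventually.of_forall fun n U => (hC n).diam_le U U.2)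
    (Eventually.of_forall fun n => by simpa [Set.sUnion_eq_iUnion] using (hC n).cover)
  refine le_antisymm (hle.trans ?_) zero_le
  refine (liminf_le_liminf (Eventually.of_forall fun n => (hlt n).le)).trans ?_
  rw [ENNReal.tendsto_inv_nat_nhds_zero.liminf_eq]

theorem dimH_le_familyDimH (Φ : Set (Set ℝ)) (E : Set ℝ) : dimH E ≤ familyDimH Φ E := by
  rw [dimH_eq_iInf]
  exact iInf_mono fun s => iInf_mono' fun h => ⟨hausdorffMeasure_eq_zero_of_family h, le_rfl⟩

end Family

section CylinderFamily

variable {q : ℕ → ℝ}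

/-- The cylinders of rank `n`. -/
def cylindersOfRank (q : ℕ → ℝ) (n : ℕ) : Set (Set ℝ) :=
  Set.range fun α => cylinder q α n

theorem pairwiseDisjoint_cylindersOfRank (hq : IsQInfVector q) (n : ℕ) :
    (cylindersOfRank q n).PairwiseDisjoint id := by
  rintro _ ⟨α, rfl⟩ _ ⟨β, rfl⟩ hne
  refine Set.disjoint_left.2 fun x ha hb => hne ?_
  exact cylinder_congr (eq_of_mem_cylinder hq ha hb)

theorem countable_cylindersOfRank (hq : IsQInfVector q) (n : ℕ) :
    (cylindersOfRank q n).Countable := by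
  refine (pairwiseDisjoint_cylindersOfRank hq n).countable_of_nonempty_interior ?_
  rintro _ ⟨α, rfl⟩
  simp [cylinder, cylLength_pos hq]

theorem isEpsCovering_cylindersOfRank (hq : IsQInfVector q) {r : ℝ} (hr : ∀ i, q i ≤ r)
    {n : ℕ} (hn : 1 ≤ n) {E : Set ℝ} (hE : E ⊆ Set.Ico 0 1) :
    IsEpsCovering (cylinderFamily q) (ENNReal.ofReal (r ^ n)) E (cylindersOfRank q n) where
  countable := countable_cylindersOfRank hq n
  subset := by
    rintro _ ⟨α, rfl⟩
    exact ⟨α, n, hn, rfl⟩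
  diam_le := by
    rintro _ ⟨α, rfl⟩
    simp only [ediam_cylinder]
    exact ENNReal.ofReal_le_ofReal (cylLength_le_pow hq hr α n)
  cover x hx := by
    obtain ⟨α, hα⟩ := exists_forall_mem_cylinder hq (hE hx)
    exact ⟨_, ⟨α, rfl⟩, hα n⟩

theorem tsum_ediam_cylindersOfRank_le (hq : IsQInfVector q) (n : ℕ) :
    ∑' U : cylindersOfRank q n, Metric.ediam (U : Set ℝ) ≤ 1 := by
  have hvol : ∀ U : cylindersOfRank q n, Metric.ediam (U : Set ℝ) = volume (U : Set ℝ) := by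
    rintro ⟨_, α, rfl⟩
    change Metric.ediam (cylinder q α n) = volume (cylinder q α n)
    rw [ediam_cylinder, cylinder, Real.volume_Ico, add_sub_cancel_left]
  simp_rw [hvol]
  have := measure_biUnion (μ := volume) (countable_cylindersOfRank hq n)
    (pairwiseDisjoint_cylindersOfRank hq n) (by
      rintro _ ⟨α, rfl⟩
      exact measurableSet_Ico)
  simp only [id] at this
  rw [← this]
  refine (measure_mono (t := Set.Ico (0 : ℝ) 1) ?_).trans (by simp)
  refine Set.iUnion₂_subset ?_
  rintro _ ⟨α, rfl⟩
  exact cylinder_subset_Ico hq α n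

theorem exists_pow_le_of_pos {r : ℝ} (h0 : 0 < r) (h1 : r < 1) {ε : ℝ≥0∞} (hε : 0 < ε) :
    ∃ n : ℕ, 1 ≤ n ∧ ENNReal.ofReal (r ^ n) ≤ ε := by
  have h := ENNReal.tendsto_ofReal (tendsto_pow_atTop_nhds_zero_of_lt_one h0.le h1)
  rw [ENNReal.ofReal_zero] at h
  obtain ⟨n, h1, hn⟩ := ((h.eventually_lt_const hε).and (eventually_ge_atTop 1)).exists
  exact ⟨n, hn, h1.le⟩

theorem isFineFamily_cylinderFamily (hq : IsQInfVector q) :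
    IsFineFamily (Set.Ico 0 1) (cylinderFamily q) where
  subset := by
    rintro _ ⟨α, n, -, rfl⟩
    exact cylinder_subset_Ico hq α n
  exists_covering ε hε := by
    obtain ⟨r, h0, h1, hr⟩ := hq.exists_le_lt_one
    obtain ⟨n, hn, hle⟩ := exists_pow_le_of_pos h0 h1 hε
    have h := isEpsCovering_cylindersOfRank hq hr hn (subset_refl (Set.Ico (0 : ℝ) 1))
    exact ⟨_, h.countable, h.subset, fun U hU => (h.diam_le U hU).trans hle, h.cover⟩

theorem familyDimH_cylinderFamily_le_one (hq : IsQInfVector q) {E : Set ℝ}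
    (hE : E ⊆ Set.Ico 0 1) : familyDimH (cylinderFamily q) E ≤ 1 := by
  obtain ⟨r, h0, h1, hr⟩ := hq.exists_le_lt_one
  refine le_of_forall_gt_imp_ge_of_dense fun s' hs' => ?_
  rcases eq_or_ne s' ∞ with rfl | htop
  · exact le_top
  lift s' to ℝ≥0 using htop
  have hs1 : (1 : ℝ) < s' := by exact_mod_cast hs'
  refine iInf₂_le s' (familyHausdorffMeasure_eq_zero_iff.2 fun ε hε => ?_)
  refine le_antisymm (le_of_forall_gt_imp_ge_of_dense fun η hη => ?_) zero_le
  -- With ranks so large that `(rⁿ) ^ (s' - 1) ≤ η`, the sum is at most `η` times the total length.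
  have hη' : 0 < min ε (η ^ (s' - 1 : ℝ)⁻¹) :=
    lt_min hε (ENNReal.rpow_pos_of_nonneg hη (by simpa using hs1.le))
  obtain ⟨n, hn, hle⟩ := exists_pow_le_of_pos h0 h1 hη'
  have hcov := isEpsCovering_cylindersOfRank hq hr hn hE
  refine (coveringOuterMeasure_anti (hle.trans (min_le_left _ _))).trans
    ((coveringOuterMeasure_le hcov).trans ?_)
  calc ∑' U : cylindersOfRank q n, Metric.ediam (U : Set ℝ) ^ (s' : ℝ)
      ≤ ∑' U : cylindersOfRank q n, η * Metric.ediam (U : Set ℝ) := by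
        refine ENNReal.tsum_le_tsum fun U => ?_
        have hU : Metric.ediam (U : Set ℝ) ≤ η ^ (s' - 1 : ℝ)⁻¹ :=
          (hcov.diam_le U U.2).trans (hle.trans (min_le_right _ _))
        have hs : (s' : ℝ) = (s' - 1) + 1 := by ring
        rw [hs, ENNReal.rpow_add_of_nonneg _ _ (by linarith) zero_le_one, ENNReal.rpow_one]
        gcongr
        rwa [ENNReal.le_rpow_inv_iff (by linarith)] at hU
    _ ≤ η := by
        rw [ENNReal.tsum_mul_left]
        exact mul_le_of_le_one_right' (tsum_ediam_cylindersOfRank_le hq n)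

end CylinderFamily

/-! ### Economical coverings of intervals by cylinders -/

section Sufficiency

variable {q : ℕ → ℝ}

/-- The cost in exponent `s` of the children, with digits in `S`, of a cylinder of length `L`. The
condition on `q` only concerns long blocks of large digits, but the other children are few and no
longer than `l`. -/
theorem sum_mul_rpow_le (hq : IsQInfVector q) {s δ : ℝ} (hδ : 0 < δ) (hδs : δ < s) {N : ℕ}
    (hN : ∀ n M : ℕ, N < n → N < M →
      ∑ i ∈ Finset.Icc n (n + M), q i ^ s ≤ (∑ i ∈ Finset.Icc n (n + M), q i) ^ (s - δ))
    {L l : ℝ} (hL : 0 < L) (hL1 : L ≤ 1) (hl : 0 < l) (hl1 : l ≤ 1) {S : Set ℕ}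
    (hS : ∀ n ∈ S, ∀ m ∈ S, n ≤ m → L * ∑ i ∈ Finset.Icc n m, q i ≤ l)
    (F : Finset ℕ) (hF : ↑F ⊆ S) :
    ∑ i ∈ F, (L * q i) ^ s ≤ (2 * N + 2) * l ^ (s - δ) := by
  set c := l ^ (s - δ) with hc
  have hs : 0 < s := hδ.trans hδs
  have hcpos : 0 < c := Real.rpow_pos_of_pos hl _
  have hpt : ∀ i ∈ F, (L * q i) ^ s ≤ c := by
    intro i hi
    have h := hS i (hF hi) i (hF hi) le_rfl
    rw [Finset.Icc_self, Finset.sum_singleton] at h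
    exact (Real.rpow_le_rpow (mul_pos hL (hq.pos i)).le h hs.le).trans
      (Real.rpow_le_rpow_of_exponent_ge hl hl1 (by linarith))
  have hcard : ∀ G ⊆ F, G.card ≤ N + 1 → ∑ i ∈ G, (L * q i) ^ s ≤ (N + 1) * c := by
    intro G hG hG'
    refine (Finset.sum_le_card_nsmul G _ c fun i hi => hpt i (hG hi)).trans ?_
    rw [nsmul_eq_mul]
    gcongr
    exact_mod_cast hG'
  have hfar : ∑ i ∈ F with ¬ i ≤ N, (L * q i) ^ s ≤ (N + 1) * c := by
    set G := F.filter fun i => ¬ i ≤ N with hG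
    have hGF : G ⊆ F := Finset.filter_subset _ _
    rcases G.eq_empty_or_nonempty with h0 | hne
    · rw [h0, Finset.sum_empty]
      positivity
    have hnm : G.min' hne ≤ G.max' hne := G.min'_le_max' hne
    have hnN : N < G.min' hne := not_le.1 (Finset.mem_filter.1 (G.min'_mem hne)).2
    have hGI : G ⊆ Finset.Icc (G.min' hne) (G.max' hne) := fun i hi =>
      Finset.mem_Icc.2 ⟨G.min'_le i hi, G.le_max' i hi⟩
    have hnS := hF (hGF (G.min'_mem hne))
    have hmS := hF (hGF (G.max'_mem hne))
    generalize G.min' hne = n at *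
    generalize G.max' hne = m at *
    obtain ⟨M, rfl⟩ := Nat.exists_eq_add_of_le hnm
    -- A short block contributes few terms; a long one is controlled by the condition on `q`.
    rcases le_or_gt M N with hM | hM
    · refine hcard G hGF ((Finset.card_le_card hGI).trans ?_)
      rw [Nat.card_Icc]
      omega
    · have hsum : 0 ≤ ∑ i ∈ Finset.Icc n (n + M), q i := Finset.sum_nonneg fun i _ => (hq.pos i).le
      calc ∑ i ∈ G, (L * q i) ^ s ≤ ∑ i ∈ Finset.Icc n (n + M), (L * q i) ^ s :=
            Finset.sum_le_sum_of_subset_of_nonneg hGI fun i _ _ =>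
              Real.rpow_nonneg (mul_pos hL (hq.pos i)).le _
        _ = L ^ s * ∑ i ∈ Finset.Icc n (n + M), q i ^ s := by
            rw [Finset.mul_sum]
            exact Finset.sum_congr rfl fun i _ => Real.mul_rpow hL.le (hq.pos i).le
        _ ≤ L ^ (s - δ) * (∑ i ∈ Finset.Icc n (n + M), q i) ^ (s - δ) :=
            mul_le_mul (Real.rpow_le_rpow_of_exponent_ge hL hL1 (by linarith)) (hN n M hnN hM)
              (Finset.sum_nonneg fun i _ => Real.rpow_nonneg (hq.pos i).le _)
              (Real.rpow_nonneg hL.le _)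
        _ = (L * ∑ i ∈ Finset.Icc n (n + M), q i) ^ (s - δ) := (Real.mul_rpow hL.le hsum).symm
        _ ≤ c := Real.rpow_le_rpow (mul_nonneg hL.le hsum) (hS n hnS _ hmS hnm) (by linarith)
        _ ≤ (N + 1) * c := le_mul_of_one_le_left hcpos.le (by linarith [N.cast_nonneg (α := ℝ)])
  rw [← Finset.sum_filter_add_sum_filter_not F (fun i => i ≤ N)]
  have hnear : ∑ i ∈ F with i ≤ N, (L * q i) ^ s ≤ (N + 1) * c := by
    refine hcard _ (Finset.filter_subset _ _) ?_
    rw [← Finset.card_range (N + 1)]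
    refine Finset.card_le_card fun i hi => ?_
    have := (Finset.mem_filter.1 hi).2
    exact Finset.mem_range.2 (by omega)
  linarith

/-- The cylinder obtained from the one of rank `k` with digits `α 0, …, α (k - 1)` by appending
the digit `i`. -/
def childCylinder (q : ℕ → ℝ) (α : ℕ → ℕ) (k i : ℕ) : Set ℝ :=
  cylinder q (Function.update α k i) (k + 1)

theorem childCylinder_eq (q : ℕ → ℝ) (α : ℕ → ℕ) (k i : ℕ) : childCylinder q α k i =
    Set.Ico (cylLeft q α k + cylLength q α k * ∑ j ∈ Finset.range i, q j)
      (cylLeft q α k + cylLength q α k * ∑ j ∈ Finset.range (i + 1), q j) := by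
  have hc : ∀ j < k, Function.update α k i j = α j := fun j hj => Function.update_of_ne hj.ne _ _
  rw [childCylinder, cylinder_succ, cylLeft_congr hc, cylLength_congr hc, Function.update_self]

theorem ediam_childCylinder (q : ℕ → ℝ) (α : ℕ → ℕ) (k i : ℕ) :
    Metric.ediam (childCylinder q α k i) = ENNReal.ofReal (cylLength q α k * q i) := by
  rw [childCylinder_eq, Real.ediam_Ico, Finset.sum_range_succ]
  congr 1
  ring

theorem mul_sum_Icc_le_of_childCylinder_subset (hq : IsQInfVector q) {α : ℕ → ℕ} {k n m : ℕ}
    {a b : ℝ} (hnm : n ≤ m) (hn : childCylinder q α k n ⊆ Set.Icc a b)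
    (hm : childCylinder q α k m ⊆ Set.Icc a b) :
    cylLength q α k * ∑ i ∈ Finset.Icc n m, q i ≤ b - a := by
  have hL := cylLength_pos hq α k
  have hlt : ∀ i, cylLeft q α k + cylLength q α k * ∑ j ∈ Finset.range i, q j <
      cylLeft q α k + cylLength q α k * ∑ j ∈ Finset.range (i + 1), q j := fun i => by
    have := mul_lt_mul_of_pos_left (hq.strictMono_sum_range i.lt_succ_self) hL
    simpa using this
  rw [childCylinder_eq] at hn hm
  have h1 : a ≤ cylLeft q α k + cylLength q α k * ∑ j ∈ Finset.range n, q j :=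
    (hn ⟨le_rfl, hlt n⟩).1
  have h2 : cylLeft q α k + cylLength q α k * ∑ j ∈ Finset.range (m + 1), q j ≤ b := by
    have := closure_mono hm
    rw [closure_Ico (hlt m).ne, isClosed_Icc.closure_eq] at this
    exact (this (Set.right_mem_Icc.2 (hlt m).le)).2
  have h3 : ∑ i ∈ Finset.Icc n m, q i =
      ∑ j ∈ Finset.range (m + 1), q j - ∑ j ∈ Finset.range n, q j := by
    rw [← Finset.sum_Ico_eq_sub _ (by omega)]
    rfl
  rw [h3, mul_sub]
  linarith

/-- The covering pieces of size at most `l` found in the cylinder of rank `k` with digits from `α`: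
the next-rank cylinders contained in `[a, b]`, and the one with digits from `α` if it has length at
most `l`. -/
def piecesOfRank (q : ℕ → ℝ) (a b l : ℝ) (α : ℕ → ℕ) (k : ℕ) : Set ℝ :=
  (⋃ i ∈ {i | childCylinder q α k i ⊆ Set.Icc a b}, childCylinder q α k i) ∪
    ⋃ (_ : cylLength q α (k + 1) ≤ l), cylinder q α (k + 1)

theorem coveringOuterMeasure_piecesOfRank_le (hq : IsQInfVector q) {s : ℝ≥0} {δ : ℝ} (hδ : 0 < δ)
    (hδs : δ < s) {N : ℕ} (hN : ∀ n M : ℕ, N < n → N < M →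
      ∑ i ∈ Finset.Icc n (n + M), q i ^ (s : ℝ) ≤
        (∑ i ∈ Finset.Icc n (n + M), q i) ^ ((s : ℝ) - δ))
    {a b l : ℝ} (hl : 0 < l) (hl1 : l ≤ 1) (hab : b - a ≤ l) (α : ℕ → ℕ) (k : ℕ) :
    coveringOuterMeasure (cylinderFamily q) s (ENNReal.ofReal l) (piecesOfRank q a b l α k) ≤
      ENNReal.ofReal ((2 * N + 3) * l ^ ((s : ℝ) - δ)) := by
  have hL := cylLength_pos hq α k
  set S := {i | childCylinder q α k i ⊆ Set.Icc a b} with hSdef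
  have hS : ∀ n ∈ S, ∀ m ∈ S, n ≤ m → cylLength q α k * ∑ i ∈ Finset.Icc n m, q i ≤ l :=
    fun n hn m hm hnm => (mul_sum_Icc_le_of_childCylinder_subset hq hnm hn hm).trans hab
  have hrpow : ∀ {x : ℝ}, 0 ≤ x →
      ENNReal.ofReal x ^ (s : ℝ) = ENNReal.ofReal (x ^ (s : ℝ)) := fun hx =>
    ENNReal.ofReal_rpow_of_nonneg hx s.2
  have hfirst : coveringOuterMeasure (cylinderFamily q) s (ENNReal.ofReal l)
      (⋃ i ∈ S, childCylinder q α k i) ≤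
        ENNReal.ofReal ((2 * N + 2) * l ^ ((s : ℝ) - δ)) := by
    refine (measure_biUnion_le _ S.to_countable _).trans ?_
    calc ∑' i : S, coveringOuterMeasure (cylinderFamily q) s (ENNReal.ofReal l)
          (childCylinder q α k i)
        ≤ ∑' i : S, ENNReal.ofReal ((cylLength q α k * q i) ^ (s : ℝ)) := by
          refine ENNReal.tsum_le_tsum fun i => ?_
          rw [← hrpow (mul_pos hL (hq.pos i)).le, ← ediam_childCylinder]
          refine coveringOuterMeasure_le_ediam_rpow ⟨_, k + 1, Nat.le_add_left 1 k, rfl⟩ ?_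
          rw [ediam_childCylinder]
          have := hS i i.2 i i.2 le_rfl
          rw [Finset.Icc_self, Finset.sum_singleton] at this
          exact ENNReal.ofReal_le_ofReal this
      _ ≤ ENNReal.ofReal ((2 * N + 2) * l ^ ((s : ℝ) - δ)) := by
          rw [ENNReal.tsum_eq_iSup_sum]
          refine iSup_le fun F => ?_
          rw [← ENNReal.ofReal_sum_of_nonneg fun (i : S) _ =>
            Real.rpow_nonneg (mul_pos hL (hq.pos i)).le _]
          refine ENNReal.ofReal_le_ofReal ?_
          have := sum_mul_rpow_le hq hδ hδs hN hL (cylLength_le_one hq α k) hl hl1 hS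
            (F.map (Function.Embedding.subtype _)) (by
              intro i hi
              simp only [Finset.coe_map, Set.mem_image] at hi
              obtain ⟨j, -, rfl⟩ := hi
              exact j.2)
          rwa [Finset.sum_map] at this
  have hsecond : coveringOuterMeasure (cylinderFamily q) s (ENNReal.ofReal l)
      (⋃ (_ : cylLength q α (k + 1) ≤ l), cylinder q α (k + 1)) ≤
        ENNReal.ofReal (l ^ ((s : ℝ) - δ)) := by
    by_cases h : cylLength q α (k + 1) ≤ l
    · simp only [h, Set.iUnion_true]
      have hΦ : cylinder q α (k + 1) ∈ cylinderFamily q := ⟨α, k + 1, Nat.le_add_left 1 k, rfl⟩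
      refine (coveringOuterMeasure_le_ediam_rpow hΦ ?_).trans ?_
      · rw [ediam_cylinder]
        exact ENNReal.ofReal_le_ofReal h
      · rw [ediam_cylinder, hrpow (cylLength_pos hq α _).le]
        refine ENNReal.ofReal_le_ofReal ?_
        exact (Real.rpow_le_rpow (cylLength_pos hq α _).le h s.2).trans
          (Real.rpow_le_rpow_of_exponent_ge hl hl1 (sub_le_self _ hδ.le))
    · simp [h]
  refine (measure_union_le _ _).trans ((add_le_add hfirst hsecond).trans ?_)
  have hc := (Real.rpow_pos_of_pos hl ((s : ℝ) - δ)).le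
  rw [← ENNReal.ofReal_add (by positivity) hc]
  exact ENNReal.ofReal_le_ofReal (by linarith)

/-- An interval of length at most `l` can be covered by cylinders no longer than `l`, with a loss of
`2 δ` in the exponent. The bound `l` may exceed `b - a`, so degenerate intervals are
included. -/
theorem exists_coveringOuterMeasure_Icc_le (hq : IsQInfVector q) {s : ℝ≥0} {δ : ℝ} (hδ : 0 < δ)
    (hδs : δ < s) {N : ℕ} (hN : ∀ n M : ℕ, N < n → N < M →
      ∑ i ∈ Finset.Icc n (n + M), q i ^ (s : ℝ) ≤
        (∑ i ∈ Finset.Icc n (n + M), q i) ^ ((s : ℝ) - δ)) :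
    ∃ K : ℝ, 0 < K ∧ ∀ a b l : ℝ, 0 < l → l < 1 → b - a ≤ l →
      coveringOuterMeasure (cylinderFamily q) s (ENNReal.ofReal l)
        (Set.Icc a b ∩ Set.Ico 0 1) ≤ ENNReal.ofReal (K * l ^ ((s : ℝ) - 2 * δ)) := by
  obtain ⟨r, h0, h1, hr⟩ := hq.exists_le_lt_one
  have hrδ0 : 0 < r ^ δ := Real.rpow_pos_of_pos h0 _
  have hrδ1 : r ^ δ < 1 := Real.rpow_lt_one h0.le h1 hδ
  have hgeom := hasSum_geometric_of_lt_one hrδ0.le hrδ1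
  have hinv : 0 < (1 - r ^ δ)⁻¹ := inv_pos.2 (by linarith)
  refine ⟨2 * ((2 * N + 3) * (1 - r ^ δ)⁻¹), by positivity, fun a b l hl hl1 hab => ?_⟩
  set M := coveringOuterMeasure (cylinderFamily q) s (ENNReal.ofReal l) with hM
  have hc : 0 < l ^ ((s : ℝ) - 2 * δ) := Real.rpow_pos_of_pos hl _
  -- `G α` collects the pieces of all ranks along the expansion `α`. At rank `k` a factor `l ^ δ`
  -- of the cost is at most `(r ^ δ) ^ k`, as `l` is less than the length of the cylinder.
  let G : (ℕ → ℕ) → Set ℝ := fun α =>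
    ⋃ k, ⋃ (_ : l < cylLength q α k), piecesOfRank q a b l α k
  have hG : ∀ α, M (G α) ≤
      ENNReal.ofReal ((2 * N + 3) * (1 - r ^ δ)⁻¹ * l ^ ((s : ℝ) - 2 * δ)) := by
    intro α
    refine (measure_iUnion_le _).trans ?_
    calc ∑' k, M (⋃ (_ : l < cylLength q α k), piecesOfRank q a b l α k)
        ≤ ∑' k : ℕ, ENNReal.ofReal ((2 * N + 3) * l ^ ((s : ℝ) - 2 * δ) * (r ^ δ) ^ k) := by
          refine ENNReal.tsum_le_tsum fun k => ?_
          by_cases hk : l < cylLength q α k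
          · simp only [hk, Set.iUnion_true]
            refine (coveringOuterMeasure_piecesOfRank_le hq hδ hδs hN hl hl1.le hab α k).trans
              (ENNReal.ofReal_le_ofReal ?_)
            rw [mul_assoc]
            refine mul_le_mul_of_nonneg_left ?_ (by positivity)
            have hsplit : (s : ℝ) - δ = (s - 2 * δ) + δ := by ring
            rw [hsplit, Real.rpow_add hl]
            refine mul_le_mul_of_nonneg_left ?_ hc.le
            calc l ^ δ ≤ (r ^ k) ^ δ :=
                  Real.rpow_le_rpow hl.le (hk.le.trans (cylLength_le_pow hq hr α k)) hδ.le
              _ = (r ^ δ) ^ k := by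
                  rw [← Real.rpow_natCast, ← Real.rpow_natCast, ← Real.rpow_mul h0.le,
                    ← Real.rpow_mul h0.le, mul_comm]
          · simp [hk]
      _ = ENNReal.ofReal ((2 * N + 3) * (1 - r ^ δ)⁻¹ * l ^ ((s : ℝ) - 2 * δ)) := by
          rw [← ENNReal.ofReal_tsum_of_nonneg (fun k => by positivity)
            (hgeom.summable.mul_left _), tsum_mul_left, hgeom.tsum_eq]
          congr 1
          ring
  obtain ⟨α, hα⟩ := exists_forall_eq_of_mem_cylinder hq a
  obtain ⟨β, hβ⟩ := exists_forall_eq_of_mem_cylinder hq b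
  have hsub : Set.Icc a b ∩ Set.Ico 0 1 ⊆ G α ∪ G β := by
    rintro x ⟨hxab, hx⟩
    obtain ⟨ξ, hξ⟩ := exists_forall_mem_cylinder hq hx
    -- The first rank at which the cylinder of `x` is short or contains neither `a` nor `b`.
    have hex : ∃ n, cylLength q ξ n ≤ l ∨ (a ∉ cylinder q ξ n ∧ b ∉ cylinder q ξ n) := by
      obtain ⟨n, hn⟩ := exists_pow_lt_of_lt_one hl h1
      exact ⟨n, Or.inl ((cylLength_le_pow hq hr ξ n).trans hn.le)⟩
    classical
    obtain ⟨k, hk⟩ : ∃ k, Nat.find hex = k + 1 := by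
      refine Nat.exists_eq_succ_of_ne_zero fun hz => ?_
      have hspec := Nat.find_spec hex
      rw [hz, cylinder_zero] at hspec
      rcases hspec with h | ⟨ha, hb⟩
      · rw [cylLength, Finset.range_zero, Finset.prod_empty] at h
        linarith
      · have ha0 : a < 0 := by
          by_contra! h
          exact ha ⟨h, hxab.1.trans_lt hx.2⟩
        have hb1 : 1 ≤ b := by
          by_contra! h
          exact hb ⟨hx.1.trans hxab.2, h⟩
        linarith
    have hspec := Nat.find_spec hex
    have hmin := Nat.find_min hex (m := k) (by omega)
    rw [hk] at hspec
    push Not at hmin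
    obtain ⟨hlong, hmem⟩ := hmin
    -- A cylinder which meets `[a, b]` and contains no endpoint lies in `[a, b]`.
    have hinside : a ∉ cylinder q ξ (k + 1) → b ∉ cylinder q ξ (k + 1) →
        cylinder q ξ (k + 1) ⊆ Set.Icc a b := by
      intro ha hb y hy
      have hxk := hξ (k + 1)
      constructor
      · by_contra! h
        exact ha ⟨hy.1.trans h.le, hxab.1.trans_lt hxk.2⟩
      · by_contra! h
        exact hb ⟨hxk.1.trans hxab.2, h.trans hy.2⟩
    have key : ∀ γ : ℕ → ℕ, (∀ j < k, ξ j = γ j) → cylinder q ξ (k + 1) ⊆ Set.Icc a b →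
        x ∈ G γ := by
      intro γ hγ hin
      have hch : childCylinder q γ k (ξ k) = cylinder q ξ (k + 1) := by
        refine cylinder_congr fun j hj => ?_
        rcases Nat.lt_succ_iff_lt_or_eq.1 hj with h | rfl
        · rw [Function.update_of_ne h.ne, hγ j h]
        · rw [Function.update_self]
      refine Set.mem_iUnion₂.2 ⟨k, cylLength_congr hγ ▸ hlong, Or.inl ?_⟩
      refine Set.mem_iUnion₂.2 ⟨ξ k, ?_, hch ▸ hξ (k + 1)⟩
      rw [Set.mem_ofPred_eq, hch]
      exact hin
    have key' : ∀ γ : ℕ → ℕ, (∀ j < k + 1, ξ j = γ j) → cylLength q ξ (k + 1) ≤ l → x ∈ G γ := by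
      intro γ hγ hle
      refine Set.mem_iUnion₂.2
        ⟨k, cylLength_congr (fun j hj => hγ j (hj.trans k.lt_succ_self)) ▸ hlong, Or.inr ?_⟩
      refine Set.mem_iUnion.2 ⟨cylLength_congr hγ ▸ hle, ?_⟩
      rw [← cylinder_congr hγ]
      exact hξ (k + 1)
    by_cases ha : a ∈ cylinder q ξ (k + 1)
    · exact Or.inl (key' α (hα ξ _ ha) (hspec.resolve_right fun h => h.1 ha))
    by_cases hb : b ∈ cylinder q ξ (k + 1)
    · exact Or.inr (key' β (hβ ξ _ hb) (hspec.resolve_right fun h => h.2 hb))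
    by_cases hak : a ∈ cylinder q ξ k
    · exact Or.inl (key α (hα ξ _ hak) (hinside ha hb))
    · exact Or.inr (key β (hβ ξ _ (hmem hak)) (hinside ha hb))
  refine (measure_mono hsub).trans ((measure_union_le _ _).trans
    ((add_le_add (hG α) (hG β)).trans ?_))
  rw [← ENNReal.ofReal_add (by positivity) (by positivity)]
  exact ENNReal.ofReal_le_ofReal (by linarith)

/-- If every interval `I` has a covering by cylinders with `∑ |E_j| ^ t ≤ K |I| ^ t'`, with `K`
independent of `I`, then `H^t(E, Φ)` vanishes along with the Hausdorff measure `H^t'(E)`. -/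
theorem familyHausdorffMeasure_eq_zero_of_forall_Icc {Φ : Set (Set ℝ)} {t t' : ℝ≥0} (ht' : 0 < t')
    {K : ℝ} (hK : 0 < K) (hIcc : ∀ a b l : ℝ, 0 < l → l < 1 → b - a ≤ l →
      coveringOuterMeasure Φ t (ENNReal.ofReal l) (Set.Icc a b ∩ Set.Ico 0 1) ≤
        ENNReal.ofReal (K * l ^ (t' : ℝ)))
    {E : Set ℝ} (hE : E ⊆ Set.Ico 0 1) (hzero : Measure.hausdorffMeasure (t' : ℝ) E = 0) :
    familyHausdorffMeasure Φ t E = 0 := by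
  rw [familyHausdorffMeasure_eq_zero_iff]
  intro ε hε
  have ht'0 : (0 : ℝ) < t' := ht'
  have hKtop : ENNReal.ofReal K ≠ ∞ := ENNReal.ofReal_ne_top
  have hKpos : ENNReal.ofReal K ≠ 0 := (ENNReal.ofReal_pos.2 hK).ne'
  refine le_antisymm (le_of_forall_gt_imp_ge_of_dense fun η hη => ?_) zero_le
  set v : ℝ≥0∞ := min (min ε 2⁻¹ ^ (t' : ℝ)) (η / ENNReal.ofReal K) with hv
  have hvpos : 0 < v := lt_min
    (ENNReal.rpow_pos_of_nonneg (lt_min hε (by simp)) ht'0.le) (ENNReal.div_pos hη.ne' hKtop)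
  have hv2 : 0 < v / 2 := ENNReal.half_pos hvpos.ne'
  obtain ⟨T, hcov, hTsum⟩ : ∃ T : ℕ → Set ℝ, E ⊆ ⋃ n, T n ∧
      ∑' n, ⨆ _ : (T n).Nonempty, Metric.ediam (T n) ^ (t' : ℝ) < v / 2 := by
    rw [Measure.hausdorffMeasure_apply, ENNReal.iSup_eq_zero] at hzero
    have h := hzero 1
    rw [ENNReal.iSup_eq_zero] at h
    have hlt := (h zero_lt_one).trans_lt hv2
    simp only [iInf_lt_iff] at hlt
    obtain ⟨T, hT, -, hlt⟩ := hlt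
    exact ⟨T, hT, hlt⟩
  obtain ⟨η', hη'pos, hη'sum⟩ := ENNReal.exists_pos_sum_of_countable' hv2.ne' ℕ
  -- The positive lengths `w n ^ (1 / t')` bound the diameters of the `T n`, which may vanish.
  set w : ℕ → ℝ≥0∞ := fun n => (⨆ _ : (T n).Nonempty, Metric.ediam (T n) ^ (t' : ℝ)) + η' n with hw
  have hwsum : ∑' n, w n ≤ v := by
    rw [hw, ENNReal.tsum_add, ← ENNReal.add_halves v]
    exact add_le_add hTsum.le hη'sum.le
  have hwpos : ∀ n, 0 < w n := fun n => (hη'pos n).trans_le le_add_self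
  have hwle : ∀ n, w n ^ (t' : ℝ)⁻¹ ≤ min ε 2⁻¹ := fun n => by
    rw [ENNReal.rpow_inv_le_iff ht'0]
    exact ((ENNReal.le_tsum n).trans hwsum).trans (min_le_left _ _)
  have hwtop : ∀ n, w n ^ (t' : ℝ)⁻¹ ≠ ∞ := fun n =>
    ne_top_of_le_ne_top (by simp) ((hwle n).trans (min_le_right _ _))
  have hpiece : ∀ n, coveringOuterMeasure Φ t ε (T n ∩ E) ≤ ENNReal.ofReal K * w n := by
    intro n
    rcases (T n ∩ E).eq_empty_or_nonempty with h0 | hne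
    · rw [h0, measure_empty]
      exact zero_le
    set l := (w n ^ (t' : ℝ)⁻¹).toReal with hl
    have hofl : ENNReal.ofReal l = w n ^ (t' : ℝ)⁻¹ := ENNReal.ofReal_toReal (hwtop n)
    have hlpos : 0 < l := ENNReal.toReal_pos
      (ENNReal.rpow_pos_of_nonneg (hwpos n) (inv_nonneg.2 ht'0.le)).ne' (hwtop n)
    have hl1 : l < 1 := by
      rw [hl, ← ENNReal.toReal_one, ENNReal.toReal_lt_toReal (hwtop n) ENNReal.one_ne_top]
      exact ((hwle n).trans (min_le_right _ _)).trans_lt (by simp)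
    have hbdd : Bornology.IsBounded (T n ∩ E) :=
      (Metric.isBounded_Ico 0 1).subset (Set.inter_subset_right.trans hE)
    have hdiam : sSup (T n ∩ E) - sInf (T n ∩ E) ≤ l := by
      rw [← ENNReal.ofReal_le_ofReal_iff hlpos.le, ← Real.ediam_eq hbdd, hofl,
        ENNReal.le_rpow_inv_iff ht'0]
      refine le_add_right ?_
      rw [iSup_pos hne.left]
      exact ENNReal.rpow_le_rpow (Metric.ediam_mono Set.inter_subset_left) ht'0.le
    calc coveringOuterMeasure Φ t ε (T n ∩ E)
        ≤ coveringOuterMeasure Φ t ε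
            (Set.Icc (sInf (T n ∩ E)) (sSup (T n ∩ E)) ∩ Set.Ico 0 1) :=
          measure_mono (Set.subset_inter (subset_Icc_csInf_csSup hbdd.bddBelow hbdd.bddAbove)
            (Set.inter_subset_right.trans hE))
      _ ≤ coveringOuterMeasure Φ t (ENNReal.ofReal l)
            (Set.Icc (sInf (T n ∩ E)) (sSup (T n ∩ E)) ∩ Set.Ico 0 1) :=
          coveringOuterMeasure_anti (hofl ▸ (hwle n).trans (min_le_left _ _))
      _ ≤ ENNReal.ofReal (K * l ^ (t' : ℝ)) := hIcc _ _ l hlpos hl1 hdiam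
      _ = ENNReal.ofReal K * w n := by
          rw [ENNReal.ofReal_mul hK.le, ← ENNReal.ofReal_rpow_of_pos hlpos, hofl,
            ENNReal.rpow_inv_rpow ht'0.ne']
  have hEsub : E ⊆ ⋃ n, T n ∩ E := by
    rw [← Set.iUnion_inter]
    exact Set.subset_inter hcov subset_rfl
  refine (measure_mono hEsub).trans ((measure_iUnion_le _).trans
    ((ENNReal.tsum_le_tsum hpiece).trans ?_))
  rw [ENNReal.tsum_mul_left]
  calc ENNReal.ofReal K * ∑' n, w n ≤ ENNReal.ofReal K * (η / ENNReal.ofReal K) := by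
        gcongr
        exact hwsum.trans (min_le_right _ _)
    _ = η := ENNReal.mul_div_cancel hKpos hKtop

theorem familyDimH_cylinderFamily_le_dimH (hq : IsQInfVector q)
    (h : ∀ α ∈ Set.Ioo (0 : ℝ) 1, ∀ δ ∈ Set.Ioo (0 : ℝ) α, ∃ N : ℕ, 0 < N ∧
      ∀ n M : ℕ, N < n → N < M → (∑ i ∈ Finset.Icc n (n + M), q i) ^ (α - δ) ≥
        ∑ i ∈ Finset.Icc n (n + M), q i ^ α)
    {E : Set ℝ} (hE : E ⊆ Set.Ico 0 1) : familyDimH (cylinderFamily q) E ≤ dimH E := by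
  refine le_of_forall_gt_imp_ge_of_dense fun t ht => ?_
  rcases le_or_gt 1 t with h1 | h1
  · exact (familyDimH_cylinderFamily_le_one hq hE).trans h1
  lift t to ℝ≥0 using (h1.trans ENNReal.one_lt_top).ne
  obtain ⟨t', hdim, htt⟩ := ENNReal.lt_iff_exists_nnreal_btwn.1 ht
  have ht'0 : 0 < t' := by exact_mod_cast zero_le.trans_lt hdim
  have htt' : (t' : ℝ) < t := by exact_mod_cast htt
  have ht'r : (0 : ℝ) < t' := ht'0
  have ht1 : (t : ℝ) < 1 := by exact_mod_cast h1
  set δ : ℝ := ((t : ℝ) - t') / 2 with hδ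
  have hδ0 : 0 < δ := by linarith
  have hδt : δ < t := by linarith
  obtain ⟨N, -, hN⟩ := h t ⟨by linarith, ht1⟩ δ ⟨hδ0, hδt⟩
  obtain ⟨K, hK, hIcc⟩ := exists_coveringOuterMeasure_Icc_le hq hδ0 hδt hN
  have hexp : (t : ℝ) - 2 * δ = t' := by linarith
  rw [hexp] at hIcc
  exact iInf₂_le t (familyHausdorffMeasure_eq_zero_of_forall_Icc ht'0 hK hIcc hE
    (hausdorffMeasure_of_dimH_lt hdim))

end Sufficiency

/-! ### Sets of numbers with prescribed blocks of digits -/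

section Necessity

variable {q : ℕ → ℝ}

/-- The set of all points whose `k`-th digit lies in `B k`, for every `k`. -/
noncomputable def digitSet (hq : IsQInfVector q) (B : ℕ → Finset ℕ) : Set ℝ :=
  codePoint hq '' {β | ∀ k, β k ∈ B k}

theorem digitSet_subset_Ico (hq : IsQInfVector q) (B : ℕ → Finset ℕ) :
    digitSet hq B ⊆ Set.Ico 0 1 := by
  rintro _ ⟨β, -, rfl⟩
  exact cylinder_subset_Ico hq β 0 (codePoint_mem_cylinder hq β 0)

/-- Mass distribution principle: the product of the digit distributions `p k` gives every cylinder
mass at most the `δ`-th power of its length. -/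
theorem ofReal_le_familyDimH_digitSet (hq : IsQInfVector q) {B : ℕ → Finset ℕ} {δ : ℝ}
    (p : ℕ → Measure ℕ) [∀ k, IsProbabilityMeasure (p k)] (hB : ∀ k, p k (B k) = 1)
    (hp : ∀ k i, p k {i} ≤ ENNReal.ofReal (q i ^ δ)) :
    ENNReal.ofReal δ ≤ familyDimH (cylinderFamily q) (digitSet hq B) := by
  refine le_iInf₂ fun s hs => ?_
  by_contra! hlt
  have hsδ : (s : ℝ) < δ := by
    rw [← ENNReal.ofReal_coe_nnreal] at hlt
    exact (ENNReal.ofReal_lt_ofReal_iff_of_nonneg s.2).1 hlt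
  have hδ : 0 < δ := s.2.trans_lt hsδ
  rw [familyHausdorffMeasure_eq_zero_iff] at hs
  suffices h : 1 ≤ coveringOuterMeasure (cylinderFamily q) s 1 (digitSet hq B) by
    rw [hs 1 zero_lt_one] at h
    exact absurd h (by simp)
  refine le_iInf₂ fun C hC => ?_
  set P := Measure.infinitePi p with hP
  have hmass : 1 ≤ P {β | ∀ k, β k ∈ B k} := by
    have hset : {β : ℕ → ℕ | ∀ k, β k ∈ B k} = Set.univ.pi fun k => (B k : Set ℕ) := by
      ext β
      simp
    rw [hset, hP, Measure.infinitePi_pi_univ _ fun k => (B k).measurableSet]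
    simp [hB]
  have hfam : ∀ U : Set ℝ, U ∈ C → ∃ (α : ℕ → ℕ) (n : ℕ), U = cylinder q α n := fun U hU =>
    let ⟨α, n, _, h⟩ := hC.subset hU
    ⟨α, n, h⟩
  choose! A n hA using hfam
  have hsub : {β : ℕ → ℕ | ∀ k, β k ∈ B k} ⊆
      ⋃ U ∈ C, Set.pi (Finset.range (n U)) fun k => {A U k} := by
    intro β hβ
    obtain ⟨U, hU, hx⟩ := hC.cover ⟨β, hβ, rfl⟩
    refine Set.mem_iUnion₂.2 ⟨U, hU, fun k hk => ?_⟩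
    rw [hA U hU] at hx
    exact eq_of_mem_cylinder hq (codePoint_mem_cylinder hq β _) hx k
      (Finset.mem_range.1 (Finset.mem_coe.1 hk))
  refine (hmass.trans (measure_mono hsub)).trans ((measure_biUnion_le _ hC.countable _).trans ?_)
  refine ENNReal.tsum_le_tsum fun U => ?_
  have hU := hA U U.2
  have hL := cylLength_pos hq (A U) (n U)
  have hdiam : Metric.ediam (U : Set ℝ) = ENNReal.ofReal (cylLength q (A U) (n U)) := by
    rw [← ediam_cylinder, ← hU]
  rw [hP, Measure.infinitePi_pi _ fun k _ => measurableSet_singleton _, hdiam,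
    ENNReal.ofReal_rpow_of_pos hL]
  calc ∏ k ∈ Finset.range (n U), p k {A U k}
      ≤ ∏ k ∈ Finset.range (n U), ENNReal.ofReal (q (A U k) ^ δ) :=
        Finset.prod_le_prod' fun k _ => hp k _
    _ = ENNReal.ofReal (cylLength q (A U) (n U) ^ δ) := by
        rw [← ENNReal.ofReal_prod_of_nonneg fun k _ => Real.rpow_nonneg (hq.pos _).le _,
          cylLength, Real.finsetProd_rpow _ _ fun k _ => (hq.pos _).le]
    _ ≤ ENNReal.ofReal (cylLength q (A U) (n U) ^ (s : ℝ)) :=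
        ENNReal.ofReal_le_ofReal
          (Real.rpow_le_rpow_of_exponent_ge hL (cylLength_le_one hq _ _) hsδ.le)

/-- On a block violating the condition on `q`, the distribution with weights proportional to
`q i ^ α` gives every digit mass at most `q i ^ δ`. -/
theorem exists_measure_singleton_le (hq : IsQInfVector q) {α δ : ℝ} (hδα : δ < α) {B : Finset ℕ}
    (hB : B.Nonempty) (h : (∑ i ∈ B, q i) ^ (α - δ) ≤ ∑ i ∈ B, q i ^ α) :
    ∃ p : Measure ℕ, IsProbabilityMeasure p ∧ p B = 1 ∧
      ∀ i, p {i} ≤ ENNReal.ofReal (q i ^ δ) := by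
  classical
  set W := ∑ i ∈ B, q i ^ α with hW
  have hqα : ∀ i, 0 < q i ^ α := fun i => Real.rpow_pos_of_pos (hq.pos i) _
  have hWpos : 0 < W := Finset.sum_pos (fun i _ => hqα i) hB
  let f : ℕ → ℝ≥0∞ := fun i => if i ∈ B then ENNReal.ofReal (q i ^ α / W) else 0
  have hf : ∑ i ∈ B, f i = 1 := by
    rw [Finset.sum_congr rfl fun i hi => if_pos hi,
      ← ENNReal.ofReal_sum_of_nonneg fun i _ => (div_pos (hqα i) hWpos).le, ← Finset.sum_div,
      ← hW, div_self hWpos.ne', ENNReal.ofReal_one]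
  have hf' : ∀ i, i ∉ B → f i = 0 := fun i hi => if_neg hi
  refine ⟨(PMF.ofFinset f B hf hf').toMeasure, inferInstance, ?_, fun i => ?_⟩
  · rw [PMF.toMeasure_apply_eq_one_iff _ B.measurableSet, PMF.support_ofFinset]
    exact Set.inter_subset_left
  · rw [PMF.toMeasure_apply_singleton _ _ (measurableSet_singleton i), PMF.ofFinset_apply]
    by_cases hi : i ∈ B
    · rw [show f i = _ from if_pos hi]
      refine ENNReal.ofReal_le_ofReal ((div_le_iff₀ hWpos).2 ?_)
      have hqi : q i ≤ ∑ j ∈ B, q j :=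
        Finset.single_le_sum (f := q) (fun j _ => (hq.pos j).le) hi
      calc q i ^ α = q i ^ δ * q i ^ (α - δ) := by
            rw [← Real.rpow_add (hq.pos i), add_sub_cancel]
        _ ≤ q i ^ δ * W := by
            gcongr
            · exact Real.rpow_nonneg (hq.pos i).le _
            · exact (Real.rpow_le_rpow (hq.pos i).le hqi (by linarith)).trans h
    · rw [hf' i hi]
      exact zero_le

/-- The sequence with first terms `w` and all further terms `0`. -/
def extendWord {n : ℕ} (w : Fin n → ℕ) : ℕ → ℕ := fun k => if h : k < n then w ⟨k, h⟩ else 0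

theorem cylLength_extendWord (q : ℕ → ℝ) {n : ℕ} (w : Fin n → ℕ) :
    cylLength q (extendWord w) n = ∏ k, q (w k) := by
  rw [cylLength, Finset.prod_range]
  exact Finset.prod_congr rfl fun k _ => by simp [extendWord]

/-- Inside a cylinder of rank `n` the set is covered by the hull of the next-rank cylinders with
last digit in `B n`, of relative length the sum of `q` over this block. -/
theorem hausdorffMeasure_digitSet_eq_zero (hq : IsQInfVector q) {B : ℕ → Finset ℕ} {s : ℝ}
    (hs : 0 < s) (hI : ∀ k, ∃ n m, n ≤ m ∧ B k = Finset.Icc n m)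
    (hB : ∀ n, (∑ i ∈ B n, q i) ^ s * ∏ k ∈ Finset.range n, ∑ i ∈ B k, q i ^ s ≤ (1 / 2 : ℝ) ^ n) :
    Measure.hausdorffMeasure s (digitSet hq B) = 0 := by
  obtain ⟨r, h0, h1, hr⟩ := hq.exists_le_lt_one
  choose lo hi hlohi hIcc using hI
  have hr0 : Tendsto (fun n : ℕ => ENNReal.ofReal (r ^ n)) atTop (𝓝 0) := by
    simpa using ENNReal.tendsto_ofReal (tendsto_pow_atTop_nhds_zero_of_lt_one h0.le h1)
  let W : ℕ → Type := fun n => Fintype.piFinset fun k : Fin n => B k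
  let hull : ∀ n, W n → Set ℝ := fun n w =>
    Set.Icc (cylLeft q (extendWord w.1) n +
        cylLength q (extendWord w.1) n * ∑ j ∈ Finset.range (lo n), q j)
      (cylLeft q (extendWord w.1) n +
        cylLength q (extendWord w.1) n * ∑ j ∈ Finset.range (hi n + 1), q j)
  have hdiam : ∀ n w, Metric.ediam (hull n w) =
      ENNReal.ofReal (cylLength q (extendWord w.1) n * ∑ i ∈ B n, q i) := by
    intro n w
    have h3 : ∑ i ∈ B n, q i =
        ∑ j ∈ Finset.range (hi n + 1), q j - ∑ j ∈ Finset.range (lo n), q j := by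
      rw [hIcc, ← Finset.sum_Ico_eq_sub _ (by have := hlohi n; omega)]
      rfl
    rw [Real.ediam_Icc, h3]
    congr 1
    ring
  have hS : ∀ n, 0 ≤ ∑ i ∈ B n, q i := fun n => Finset.sum_nonneg fun i _ => (hq.pos i).le
  have hcover : ∀ n, digitSet hq B ⊆ ⋃ w, hull n w := by
    rintro n _ ⟨β, hβ, rfl⟩
    have hmem : (fun k : Fin n => β k) ∈ Fintype.piFinset fun k : Fin n => B k :=
      Fintype.mem_piFinset.2 fun k => hβ k
    refine Set.mem_iUnion.2 ⟨⟨_, hmem⟩, ?_⟩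
    have hext : ∀ k < n, extendWord (fun k : Fin n => β k) k = β k := fun k hk => by
      simp [extendWord, hk]
    have hx := codePoint_mem_cylinder hq β (n + 1)
    rw [cylinder_succ] at hx
    have hL := (cylLength_pos hq β n).le
    have hβn := hβ n
    rw [hIcc, Finset.mem_Icc] at hβn
    have hmono := hq.strictMono_sum_range.monotone
    have hlo := mul_le_mul_of_nonneg_left (hmono hβn.1) hL
    have hhi := mul_le_mul_of_nonneg_left (hmono (Nat.succ_le_succ hβn.2)) hL
    simp only [hull, cylLeft_congr hext, cylLength_congr hext]
    exact ⟨(by gcongr : _ ≤ _).trans hx.1, hx.2.le.trans (by gcongr : _ ≤ _)⟩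
  have hle := Measure.hausdorffMeasure_le_liminf_sum s (digitSet hq B) (l := atTop) _ hr0 hull
    (Eventually.of_forall fun n w => by
      rw [hdiam]
      refine ENNReal.ofReal_le_ofReal ?_
      exact (mul_le_of_le_one_right (cylLength_pos hq _ n).le (hq.sum_le_one _)).trans
        (cylLength_le_pow hq hr _ n))
    (Eventually.of_forall hcover)
  have hsum : ∀ n, ∑ w, Metric.ediam (hull n w) ^ s ≤ ENNReal.ofReal ((1 / 2 : ℝ) ^ n) := by
    intro n
    calc ∑ w, Metric.ediam (hull n w) ^ s
        = ∑ w : W n, ENNReal.ofReal ((∏ k, q (w.1 k) ^ s) * (∑ i ∈ B n, q i) ^ s) := by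
          refine Finset.sum_congr rfl fun w _ => ?_
          have hL := (cylLength_pos hq (extendWord w.1) n).le
          rw [hdiam, ENNReal.ofReal_rpow_of_nonneg (mul_nonneg hL (hS n)) hs.le,
            Real.mul_rpow hL (hS n), cylLength_extendWord,
            Real.finsetProd_rpow _ _ fun k _ => (hq.pos _).le]
      _ = ENNReal.ofReal
            ((∑ w : W n, ∏ k, q (w.1 k) ^ s) * (∑ i ∈ B n, q i) ^ s) := by
          rw [← ENNReal.ofReal_sum_of_nonneg, Finset.sum_mul]
          exact fun w _ => mul_nonneg
            (Finset.prod_nonneg fun k _ => Real.rpow_nonneg (hq.pos _).le _)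
            (Real.rpow_nonneg (hS n) _)
      _ ≤ ENNReal.ofReal ((1 / 2 : ℝ) ^ n) := by
          refine ENNReal.ofReal_le_ofReal (le_of_eq_of_le ?_ (hB n))
          rw [mul_comm, Finset.prod_range, Finset.prod_univ_sum]
          congr 1
          exact Finset.sum_coe_sort (Fintype.piFinset fun k : Fin n => B k)
            fun w => ∏ k, q (w k) ^ s
  have hhalf : Tendsto (fun n : ℕ => ENNReal.ofReal ((1 / 2 : ℝ) ^ n)) atTop (𝓝 0) := by
    simpa using ENNReal.tendsto_ofReal (tendsto_pow_atTop_nhds_zero_of_lt_one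
      (by norm_num : (0 : ℝ) ≤ 1 / 2) (by norm_num))
  refine le_antisymm (hle.trans ?_) zero_le
  refine (liminf_le_liminf (Eventually.of_forall hsum)).trans ?_
  rw [hhalf.liminf_eq]

/-- Greedy choice of blocks: if nonempty blocks satisfying `R` have arbitrarily small sums, they can
be chosen so small, in terms of the earlier ones, that `hausdorffMeasure_digitSet_eq_zero`
applies. -/
theorem exists_blocks (hq : IsQInfVector q) {s : ℝ} {R : Finset ℕ → Prop}
    (hR : ∀ η : ℝ, 0 < η → ∃ B, R B ∧ B.Nonempty ∧ (∑ i ∈ B, q i) ^ s ≤ η) :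
    ∃ B : ℕ → Finset ℕ, (∀ k, R (B k) ∧ (B k).Nonempty) ∧ ∀ n,
      (∑ i ∈ B n, q i) ^ s * ∏ k ∈ Finset.range n, ∑ i ∈ B k, q i ^ s ≤ (1 / 2 : ℝ) ^ n := by
  choose! pick hpick hne hle using hR
  -- `P n` is the product of the sums of `q i ^ s` over the first `n` blocks.
  let P : ℕ → ℝ := fun n => Nat.rec 1 (fun n x => x * ∑ i ∈ pick ((1 / 2 : ℝ) ^ n / x), q i ^ s) n
  let B : ℕ → Finset ℕ := fun n => pick ((1 / 2 : ℝ) ^ n / P n)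
  have hsucc : ∀ n, P (n + 1) = P n * ∑ i ∈ B n, q i ^ s := fun _ => rfl
  have hpos : ∀ n, 0 < P n := by
    intro n
    induction n with
    | zero => exact one_pos
    | succ n ih =>
      rw [hsucc]
      exact mul_pos ih (Finset.sum_pos (fun i _ => Real.rpow_pos_of_pos (hq.pos i) _)
        (hne _ (by positivity)))
  have hη : ∀ n, 0 < (1 / 2 : ℝ) ^ n / P n := fun n => div_pos (by positivity) (hpos n)
  have hprod : ∀ n, ∏ k ∈ Finset.range n, ∑ i ∈ B k, q i ^ s = P n := by
    intro n
    induction n with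
    | zero => rfl
    | succ n ih => rw [Finset.prod_range_succ, ih, hsucc]
  refine ⟨B, fun k => ⟨hpick _ (hη k), hne _ (hη k)⟩, fun n => ?_⟩
  rw [hprod, ← le_div_iff₀ (hpos n)]
  exact hle _ (hη n)

theorem exists_sum_Icc_rpow_le (hq : IsQInfVector q) {s η : ℝ} (hs : 0 < s) (hη : 0 < η) :
    ∃ N : ℕ, 0 < N ∧ ∀ n m, N < n → (∑ i ∈ Finset.Icc n m, q i) ^ s ≤ η := by
  have hlim : Tendsto (fun n => 1 - ∑ i ∈ Finset.range n, q i) atTop (𝓝 0) := by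
    simpa using hq.hasSum.tendsto_sum_nat.const_sub 1
  obtain ⟨N, hN, hN0⟩ := ((hlim.eventually_lt_const (Real.rpow_pos_of_pos hη s⁻¹)).and
    (eventually_gt_atTop 0)).exists
  refine ⟨N, hN0, fun n m hn => ?_⟩
  have hdisj : Disjoint (Finset.range N) (Finset.Icc n m) := by
    refine Finset.disjoint_left.2 fun i h1 h2 => ?_
    rw [Finset.mem_range] at h1
    rw [Finset.mem_Icc] at h2
    omega
  have hsum := hq.sum_le_one (Finset.range N ∪ Finset.Icc n m)
  rw [Finset.sum_union hdisj] at hsum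
  rw [← Real.le_rpow_inv_iff_of_pos (Finset.sum_nonneg fun i _ => (hq.pos i).le) hη.le hs]
  linarith

theorem rpow_sum_ge_of_familyDimH_eq (hq : IsQInfVector q)
    (h : ∀ E ⊆ Set.Ico (0 : ℝ) 1, familyDimH (cylinderFamily q) E = dimH E) {α δ : ℝ}
    (hδ : 0 < δ) (hδα : δ < α) :
    ∃ N : ℕ, 0 < N ∧ ∀ n M : ℕ, N < n → N < M →
      (∑ i ∈ Finset.Icc n (n + M), q i) ^ (α - δ) ≥ ∑ i ∈ Finset.Icc n (n + M), q i ^ α := by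
  by_contra! hcon
  have hs : 0 < δ / 2 := by linarith
  obtain ⟨B, hB, hsmall⟩ := exists_blocks hq (s := δ / 2)
    (R := fun B => (∃ n m, n ≤ m ∧ B = Finset.Icc n m) ∧
      (∑ i ∈ B, q i) ^ (α - δ) ≤ ∑ i ∈ B, q i ^ α) (by
    intro η hη
    obtain ⟨N, hN0, hN⟩ := exists_sum_Icc_rpow_le hq hs hη
    obtain ⟨n, M, hn, -, hlt⟩ := hcon N hN0
    exact ⟨_, ⟨⟨n, n + M, Nat.le_add_right _ _, rfl⟩, hlt.le⟩,
      Finset.nonempty_Icc.2 (Nat.le_add_right _ _), hN n _ hn⟩)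
  have hmeas := hausdorffMeasure_digitSet_eq_zero hq hs (fun k => (hB k).1.1) hsmall
  have hp := fun k => exists_measure_singleton_le hq hδα (hB k).2 (hB k).1.2
  choose p hprob hpB hple using hp
  have hlow := ofReal_le_familyDimH_digitSet hq p hpB hple
  rw [h _ (digitSet_subset_Ico hq B)] at hlow
  have hcoe : ((δ / 2).toNNReal : ℝ) = δ / 2 := Real.coe_toNNReal _ hs.le
  have hup : dimH (digitSet hq B) ≤ ENNReal.ofReal (δ / 2) :=
    dimH_le_of_hausdorffMeasure_ne_top (by rw [hcoe, hmeas]; exact ENNReal.zero_ne_top)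
  have := (ENNReal.ofReal_le_ofReal_iff hs.le).1 (hlow.trans hup)
  linarith

end Necessity

theorem theorem2p3 (q : ℕ → ℝ) (hq : IsQInfVector q) :
    IsFaithfulFamily (Set.Ico 0 1) (cylinderFamily q) ↔
      ∀ α ∈ Set.Ioo (0 : ℝ) 1, ∀ δ ∈ Set.Ioo (0 : ℝ) α,
        ∃ N : ℕ, 0 < N ∧ ∀ n M : ℕ, N < n → N < M →
          (∑ i ∈ Finset.Icc n (n + M), q i) ^ (α - δ) ≥
            ∑ i ∈ Finset.Icc n (n + M), q i ^ α := by
  constructor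
  · intro h α _ δ hδ
    exact rpow_sum_ge_of_familyDimH_eq hq h.dim_eq hδ.1 hδ.2
  · intro h
    exact ⟨isFineFamily_cylinderFamily hq, fun E hE =>
      le_antisymm (familyDimH_cylinderFamily_le_dimH hq h hE) (dimH_le_familyDimH _ E)⟩
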